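/- Let $\gamma_d$ be the standard Gaussian measure on $\mathbb{R}^d$, let $\nu$ be a probability measure on $\mathbb{R}^d$ whose support is contained in a closed ball of radius $R$ (with an arbitrary centre), and let $\mu = \gamma_d \star \nu$. Let $Q_t g(x) = \int g(e^{-t}x + \sqrt{1-e^{-2t}}\,y)\,d\gamma_d(y)$ be the Ornstein–Uhlenbeck semigroup, let $f = d\mu/d\gamma_d$, and let $V_t = -\nabla \log Q_t f$. Then the flow $(S_t)_{t\ge 0}$ given by $S_0(x)=x$, $\frac{d}{dt}S_t(x) = V_t(S_t(x))$ for $t>0$, with $t\mapsto S_t(x)$ continuous on $[0,\infty)$, exists and consists of bijections of $\mathbb{R}^d$; with $T_t = S_t^{-1}$, the limit $\Phi(x) = \lim_{t\to\infty} T_t(x)$ exists for every $x\in\mathbb{R}^d$, and the map $\Phi$ so obtained (the Kim–Milman map) is unique. It satisfies $\Phi_*\gamma_d = \mu$, it is differentiable at almost every $x\in\mathbb{R}^d$ with $$\|D\Phi(x)\|_{\mathrm{op}} \le e^{R^2/2} \quad\text{for almost every } x \in \mathbb{R}^d,$$ and $\Phi$ is Lipschitz with constant $e^{R^2/2}$,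 which does not depend on the dimension $d$. -/

import Mathlib

open MeasureTheory ProbabilityTheory Filter Topology

noncomputable section

/-- The Ornstein-Uhlenbeck semigroup on `ℝ^d`:
`Q_t g (x) = ∫ g (e^{-t} x + √(1 - e^{-2t}) y) dγ_d(y)`,
where `γ_d` is the standard Gaussian measure. -/
def ouSemigroup {d : ℕ} (t : ℝ) (g : EuclideanSpace ℝ (Fin d) → ℝ)
    (x : EuclideanSpace ℝ (Fin d)) : ℝ :=
  ∫ y, g (Real.exp (-t) • x + √(1 - Real.exp (-2 * t)) • y)
    ∂(stdGaussian (EuclideanSpace ℝ (Fin d)))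

/-- The density `dμ/dγ_d` of `μ` with respect to the standard Gaussian measure. -/
def gaussianDensity {d : ℕ} (μ : Measure (EuclideanSpace ℝ (Fin d)))
    (x : EuclideanSpace ℝ (Fin d)) : ℝ :=
  (μ.rnDeriv (stdGaussian (EuclideanSpace ℝ (Fin d))) x).toReal

/-- The velocity field `V_t = -∇ log Q_t (dμ/dγ_d)` that drives `μ` to the standard Gaussian
along the Ornstein-Uhlenbeck flow. -/
def heatFlowField {d : ℕ} (μ : Measure (EuclideanSpace ℝ (Fin d))) (t : ℝ)
    (x : EuclideanSpace ℝ (Fin d)) : EuclideanSpace ℝ (Fin d) :=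
  -gradient (fun z => Real.log (ouSemigroup t (gaussianDensity μ) z)) x

/-- `S` is a flow of the field `V_t`: `S_0 = id` and `(d/dt) S_t(x) = V_t(S_t(x))`.
For `t > 0` the field does not depend on the version of the density `dμ/dγ_d`, which is only
defined up to null sets; at `t = 0` it does. So the equation is imposed for `t > 0`, together
with continuity of the trajectories on `[0, ∞)`. The values of `S t` for `t < 0` play no role. -/
structure IsHeatFlow {d : ℕ} (μ : Measure (EuclideanSpace ℝ (Fin d)))
    (S : ℝ → EuclideanSpace ℝ (Fin d) → EuclideanSpace ℝ (Fin d)) : Prop where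
  initial : ∀ x, S 0 x = x
  continuousOn : ∀ x, ContinuousOn (fun t => S t x) (Set.Ici 0)
  hasDerivAt : ∀ x, ∀ t : ℝ, 0 < t →
    HasDerivAt (fun s => S s x) (heatFlowField μ t (S t x)) t

/-- `Φ` is the Kim-Milman (heat flow) map from the standard Gaussian to `μ`: the flow maps `S_t`
of the field `V_t` are bijections with inverses `T_t`, and `Φ = lim T_t` as `t → ∞`. -/
def IsKimMilmanMap {d : ℕ} (μ : Measure (EuclideanSpace ℝ (Fin d)))
    (Φ : EuclideanSpace ℝ (Fin d) → EuclideanSpace ℝ (Fin d)) : Prop :=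
  ∃ S T : ℝ → EuclideanSpace ℝ (Fin d) → EuclideanSpace ℝ (Fin d),
    IsHeatFlow μ S ∧
    (∀ t : ℝ, 0 ≤ t →
      Function.LeftInverse (T t) (S t) ∧ Function.RightInverse (T t) (S t)) ∧
    ∀ x, Tendsto (fun t => T t x) atTop (𝓝 (Φ x))

end

/-! Substitute `s = exp (-t)`. Completing the square gives `Q_t f (x) = ∫ exp (s⟪x, z⟫ - s²‖z‖²/2)
dν(z)`, so `V_t(x) = -s • m_s(x)`, where `m_s(x) = E[Z | sZ + G = x]` is `tiltedMean ν s x`. Since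
`ds/dt = -s`, the heat flow becomes the ODE `dX/ds = m_s(X)` run backwards from `s = 1`. This field
is bounded and Lipschitz on `[0, 1]`, and regular at `s = 0`. Hence the limit `t → ∞` is harmless:
the Kim–Milman map is the flow of `m` from time `0` to time `1`.

Contraction: the derivative of `m_s` is `s` times the covariance of a tilt of `ν`, which lives in
the same ball of radius `R`. Its quadratic form therefore lies between `0` and `s R²‖w‖²`. Grönwall
gives growth of distances by at most `exp (∫₀¹ s R² ds) = exp (R²/2)`, in any dimension; Rademacher
then gives the derivative bound.

Transport: the law of `sZ + G` solves the continuity equation with velocity `m_s`. This is tested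
against `U(s, x) = φ(flow of x from s to 1)`, which is Lipschitz and constant along trajectories:
`d/ds E U(s, sZ + G) = E DU(1, Z) = E DU(1, m_s(sZ + G)) = 0`. Rademacher and Fubini replace smooth
dependence of the flow on its initial data. The carrying lemmas are `heatFlowField_eq`,
`inner_tiltedMean_sub_mem_Icc` and `integral_stdGaussian_conv_eq`. -/

noncomputable section

set_option linter.unusedSectionVars false

/-! ### Conditional means under exponential tilting -/

section TiltedMean

variable {E : Type*} [NormedAddCommGroup E] [InnerProductSpace ℝ E] [FiniteDimensional ℝ E]
  [MeasurableSpace E] [BorelSpace E]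

/-- The logarithm of the density of the standard Gaussian measure translated by `s • z`, with
respect to the standard Gaussian measure. -/
def shiftExponent (s : ℝ) (x z : E) : ℝ := s * inner ℝ x z - s ^ 2 * ‖z‖ ^ 2 / 2

/-- The conditional mean of `Z` given `s Z + G = x`, where `Z` has law `ν` and `G` is an independent
standard Gaussian vector. -/
def tiltedMean (ν : Measure E) (s : ℝ) (x : E) : E :=
  ∫ z, z ∂(ν.tilted (shiftExponent s x))

@[fun_prop]
lemma Continuous.shiftExponent {X : Type*} [TopologicalSpace X] {f : X → ℝ} {g h : X → E}
    (hf : Continuous f) (hg : Continuous g) (hh : Continuous h) :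
    Continuous (fun x => shiftExponent (f x) (g x) (h x)) := by
  unfold _root_.shiftExponent; fun_prop

variable {ν : Measure E} [IsProbabilityMeasure ν] {a : E} {R : ℝ}

lemma ae_norm_le_of_ae_mem_closedBall (hν : ∀ᵐ z ∂ν, z ∈ Metric.closedBall a R) :
    ∀ᵐ z ∂ν, ‖z‖ ≤ ‖a‖ + R := by
  filter_upwards [hν] with z hz
  have h1 : ‖z - a‖ ≤ R := by simpa [dist_eq_norm] using hz
  calc ‖z‖ = ‖a + (z - a)‖ := by simp
    _ ≤ ‖a‖ + ‖z - a‖ := norm_add_le _ _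
    _ ≤ _ := by linarith

lemma radius_nonneg_of_ae_mem_closedBall (hν : ∀ᵐ z ∂ν, z ∈ Metric.closedBall a R) : 0 ≤ R := by
  obtain ⟨z, hz⟩ := hν.exists
  exact dist_nonneg.trans hz

lemma Continuous.integrable_of_ae_mem_closedBall [IsFiniteMeasure ν]
    {F : Type*} [NormedAddCommGroup F] {h : E → F}
    (hh : Continuous h) (hν : ∀ᵐ z ∂ν, z ∈ Metric.closedBall a R) : Integrable h ν := by
  rw [← Measure.restrict_eq_self_of_ae_mem hν]
  exact hh.continuousOn.integrableOn_compact (isCompact_closedBall a R)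

lemma continuous_integral_of_ae_mem_closedBall {X F : Type*} [TopologicalSpace X]
    [FirstCountableTopology X] [LocallyCompactSpace X] [NormedAddCommGroup F] [NormedSpace ℝ F]
    {f : X → E → F} (hf : Continuous (Function.uncurry f))
    (hν : ∀ᵐ z ∂ν, z ∈ Metric.closedBall a R) : Continuous fun x => ∫ z, f x z ∂ν := by
  rw [← Measure.restrict_eq_self_of_ae_mem hν]
  exact continuous_parametric_integral_of_continuous hf (isCompact_closedBall a R)

/-- The weight `h` lets one differentiation under the integral serve both the numerator and the
normalising constant of a tilted mean. -/
lemma hasGradientAt_integral_mul_exp_shiftExponent {h : E → ℝ} (hh : Continuous h)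
    (hν : ∀ᵐ z ∂ν, z ∈ Metric.closedBall a R) (s : ℝ) (x : E) :
    HasGradientAt (fun x => ∫ z, h z * Real.exp (shiftExponent s x z) ∂ν)
      (∫ z, (h z * Real.exp (shiftExponent s x z) * s) • z ∂ν) x := by
  rw [hasGradientAt_iff_hasFDerivAt]
  have key : ∀ y z : E, HasFDerivAt (fun y => h z * Real.exp (shiftExponent s y z))
      ((h z * Real.exp (shiftExponent s y z) * s) • innerSL ℝ z) y := by
    intro y z
    have h0 : HasFDerivAt (fun y : E => inner ℝ y z) (innerSL ℝ z) y := by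
      have := (innerSL ℝ z).hasFDerivAt (x := y)
      refine this.congr_of_eventuallyEq (.of_forall fun y => ?_)
      simp [real_inner_comm]
    have h1 : HasFDerivAt (fun y => shiftExponent s y z) (s • innerSL ℝ z) y :=
      (h0.const_mul s).sub_const _
    refine (h1.exp.const_mul (h z)).congr_fderiv ?_
    rw [smul_smul, smul_smul, mul_assoc]
  have := hasFDerivAt_integral_of_dominated_of_fderiv_le (μ := ν) (𝕜 := ℝ)
    (F := fun x z => h z * Real.exp (shiftExponent s x z)) (x₀ := x)
    (F' := fun x z => (h z * Real.exp (shiftExponent s x z) * s) • innerSL ℝ z)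
    -- Dominates the derivative for all `y` in the unit ball around `x`; the negative quadratic term
    -- of the exponent is dropped.
    (bound := fun z => |h z| * Real.exp (|s| * ((‖x‖ + 1) * ‖z‖)) * |s| * ‖z‖)
    (Metric.ball_mem_nhds x one_pos)
    (.of_forall fun y => by
      have : Continuous fun z => h z * Real.exp (shiftExponent s y z) := by fun_prop
      exact this.aestronglyMeasurable)
    (Continuous.integrable_of_ae_mem_closedBall (by fun_prop) hν)
    (by
      have : Continuous fun z => (h z * Real.exp (shiftExponent s x z) * s) • innerSL ℝ z := by
        fun_prop
      exact this.aestronglyMeasurable)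
    (.of_forall fun z y hy => by
      rw [norm_smul, norm_mul, norm_mul, innerSL_apply_norm, Real.norm_eq_abs, Real.norm_eq_abs,
        Real.norm_eq_abs, Real.abs_exp]
      gcongr
      have hy' : ‖y‖ ≤ ‖x‖ + 1 := by
        have h2 : ‖y - x‖ < 1 := by simpa [dist_eq_norm] using hy
        have := norm_le_norm_add_norm_sub' y x
        linarith
      have h3 : s * inner ℝ y z ≤ |s| * (‖y‖ * ‖z‖) := by
        refine (le_abs_self _).trans ?_
        rw [abs_mul]
        gcongr
        exact abs_real_inner_le_norm y z
      have h4 : |s| * (‖y‖ * ‖z‖) ≤ |s| * ((‖x‖ + 1) * ‖z‖) := by gcongr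
      have h5 : 0 ≤ s ^ 2 * ‖z‖ ^ 2 / 2 := by positivity
      unfold shiftExponent
      linarith)
    (Continuous.integrable_of_ae_mem_closedBall (by fun_prop) hν)
    (.of_forall fun z y _ => key y z)
  refine this.congr_fderiv ?_
  ext w
  rw [ContinuousLinearMap.integral_apply (Continuous.integrable_of_ae_mem_closedBall
    (by fun_prop) hν)]
  rw [InnerProductSpace.toDual_apply_apply, real_inner_comm, ← integral_inner
    (Continuous.integrable_of_ae_mem_closedBall (by fun_prop) hν)]
  congr 1 with z
  simp [inner_smul_right, real_inner_comm]

lemma isProbabilityMeasure_tilted_shiftExponent (hν : ∀ᵐ z ∂ν, z ∈ Metric.closedBall a R)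
    (s : ℝ) (x : E) : IsProbabilityMeasure (ν.tilted (shiftExponent s x)) :=
  isProbabilityMeasure_tilted (Continuous.integrable_of_ae_mem_closedBall (by fun_prop) hν)

lemma ae_tilted_mem_closedBall (hν : ∀ᵐ z ∂ν, z ∈ Metric.closedBall a R) (s : ℝ) (x : E) :
    ∀ᵐ z ∂(ν.tilted (shiftExponent s x)), z ∈ Metric.closedBall a R :=
  tilted_absolutelyContinuous ν _ hν

lemma integral_exp_shiftExponent_pos (hν : ∀ᵐ z ∂ν, z ∈ Metric.closedBall a R) (s : ℝ) (x : E) :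
    0 < ∫ z, Real.exp (shiftExponent s x z) ∂ν :=
  integral_exp_pos (Continuous.integrable_of_ae_mem_closedBall (by fun_prop) hν)

lemma tiltedMean_eq_smul (s : ℝ) (x : E) :
    tiltedMean ν s x = (∫ z, Real.exp (shiftExponent s x z) ∂ν)⁻¹ •
      ∫ z, Real.exp (shiftExponent s x z) • z ∂ν := by
  rw [tiltedMean, integral_tilted, ← integral_smul]
  congr 1 with z
  rw [smul_smul]
  congr 1
  ring

lemma continuous_tiltedMean (hν : ∀ᵐ z ∂ν, z ∈ Metric.closedBall a R) :
    Continuous fun p : ℝ × E => tiltedMean ν p.1 p.2 := by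
  simp_rw [tiltedMean_eq_smul]
  refine Continuous.smul (Continuous.inv₀ ?_ fun p => ?_) ?_
  · exact continuous_integral_of_ae_mem_closedBall (by unfold Function.uncurry; fun_prop) hν
  · exact (integral_exp_shiftExponent_pos hν _ _).ne'
  · exact continuous_integral_of_ae_mem_closedBall (by unfold Function.uncurry; fun_prop) hν

lemma tiltedMean_mem_closedBall (hν : ∀ᵐ z ∂ν, z ∈ Metric.closedBall a R) (s : ℝ) (x : E) :
    tiltedMean ν s x ∈ Metric.closedBall a R := by
  have := isProbabilityMeasure_tilted_shiftExponent hν s x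
  have h := ae_tilted_mem_closedBall hν s x
  exact (convex_closedBall a R).integral_mem Metric.isClosed_closedBall h
    (Continuous.integrable_of_ae_mem_closedBall continuous_id h)

lemma norm_tiltedMean_le (hν : ∀ᵐ z ∂ν, z ∈ Metric.closedBall a R) (s : ℝ) (x : E) :
    ‖tiltedMean ν s x‖ ≤ ‖a‖ + R := by
  have h1 : ‖tiltedMean ν s x - a‖ ≤ R := by
    simpa [dist_eq_norm] using tiltedMean_mem_closedBall hν s x
  calc ‖tiltedMean ν s x‖ = ‖a + (tiltedMean ν s x - a)‖ := by simp
    _ ≤ ‖a‖ + ‖tiltedMean ν s x - a‖ := norm_add_le _ _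
    _ ≤ _ := by linarith

lemma inner_tiltedMean (hν : ∀ᵐ z ∂ν, z ∈ Metric.closedBall a R) (s : ℝ) (x v : E) :
    inner ℝ (tiltedMean ν s x) v = ∫ z, inner ℝ z v ∂(ν.tilted (shiftExponent s x)) := by
  have := isProbabilityMeasure_tilted_shiftExponent hν s x
  have hint : Integrable (fun z : E => z) (ν.tilted (shiftExponent s x)) :=
    Continuous.integrable_of_ae_mem_closedBall continuous_id (ae_tilted_mem_closedBall hν s x)
  rw [tiltedMean, real_inner_comm, ← integral_inner hint]
  simp_rw [real_inner_comm]

/-- Exponential family identity: the parameter `x` enters the exponent only through `s⟪x, z⟫`, so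
the quotient rule produces a covariance. -/
lemma hasDerivAt_inner_tiltedMean_line (hν : ∀ᵐ z ∂ν, z ∈ Metric.closedBall a R) (s : ℝ)
    (y w v : E) (τ : ℝ) :
    HasDerivAt (fun τ : ℝ => inner ℝ (tiltedMean ν s (y + τ • w)) v)
      (s * cov[fun z => inner ℝ z v, fun z => inner ℝ z w;
        ν.tilted (shiftExponent s (y + τ • w))]) τ := by
  have hline : HasDerivAt (fun τ : ℝ => y + τ • w) w τ := by
    simpa using ((hasDerivAt_id τ).smul_const w).const_add y
  have hd : ∀ h : E → ℝ, Continuous h →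
      HasDerivAt (fun τ : ℝ => ∫ z, h z * Real.exp (shiftExponent s (y + τ • w) z) ∂ν)
        (s * ∫ z, h z * inner ℝ z w * Real.exp (shiftExponent s (y + τ • w) z) ∂ν) τ := by
    intro h hh
    have h1 := (hasGradientAt_integral_mul_exp_shiftExponent hh hν s
      (y + τ • w)).hasFDerivAt.comp_hasDerivAt τ hline
    refine h1.congr_deriv ?_
    rw [InnerProductSpace.toDual_apply_apply, real_inner_comm, ← integral_inner
      (Continuous.integrable_of_ae_mem_closedBall (by fun_prop) hν), ← integral_const_mul]
    congr 1 with z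
    rw [inner_smul_right, real_inner_comm]
    ring
  have hexp : ∀ h : E → ℝ, ∀ x : E, ∫ z, h z ∂(ν.tilted (shiftExponent s x)) =
      (∫ z, h z * Real.exp (shiftExponent s x z) ∂ν) /
        ∫ z, 1 * Real.exp (shiftExponent s x z) ∂ν := by
    intro h x
    rw [integral_tilted, ← integral_div]
    congr 1 with z
    simp only [smul_eq_mul, one_mul]
    ring
  have hpos : (∫ z, 1 * Real.exp (shiftExponent s (y + τ • w) z) ∂ν) ≠ 0 := by
    simpa using (integral_exp_shiftExponent_pos hν s (y + τ • w)).ne'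
  have := isProbabilityMeasure_tilted_shiftExponent hν s (y + τ • w)
  have hball := ae_tilted_mem_closedBall hν s (y + τ • w)
  have hmem : ∀ u : E, MemLp (fun z => inner ℝ z u) 2
      (ν.tilted (shiftExponent s (y + τ • w))) := fun u => by
    rw [memLp_two_iff_integrable_sq (by
      have : Continuous fun z : E => inner ℝ z u := by fun_prop
      exact this.aestronglyMeasurable)]
    exact Continuous.integrable_of_ae_mem_closedBall (by fun_prop) hball
  simp_rw [inner_tiltedMean hν, hexp]
  refine ((hd (fun z => inner ℝ z v) (by fun_prop)).div (hd (fun _ => 1) continuous_const)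
    hpos).congr_deriv ?_
  rw [covariance_eq_sub (hmem v) (hmem w), hexp, hexp, hexp]
  simp only [Pi.mul_apply, one_mul] at hpos ⊢
  field_simp

/-- Crude bound, each factor being at most the diameter. It only feeds the Lipschitz condition for
existence, so its constant does not reach the final estimate. -/
lemma abs_covariance_inner_le (hν : ∀ᵐ z ∂ν, z ∈ Metric.closedBall a R) (v w : E) :
    |cov[fun z => inner ℝ z v, fun z => inner ℝ z w; ν]| ≤ (2 * R * ‖v‖) * (2 * R * ‖w‖) := by
  have hR := radius_nonneg_of_ae_mem_closedBall hν
  have hint : Integrable (fun z : E => z) ν :=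
    Continuous.integrable_of_ae_mem_closedBall continuous_id hν
  have hmean : ∀ u : E, ∫ z, inner ℝ z u ∂ν = inner ℝ (∫ z, z ∂ν) u := fun u => by
    rw [real_inner_comm, ← integral_inner hint]
    simp_rw [real_inner_comm]
  have hm : ∫ z, z ∂ν ∈ Metric.closedBall a R :=
    (convex_closedBall a R).integral_mem Metric.isClosed_closedBall hν hint
  rw [covariance]
  have := norm_integral_le_of_norm_le_const (μ := ν)
    (f := fun z => (inner ℝ z v - ∫ z, inner ℝ z v ∂ν) * (inner ℝ z w - ∫ z, inner ℝ z w ∂ν))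
    (C := (2 * R * ‖v‖) * (2 * R * ‖w‖)) ?_
  · simpa using this
  filter_upwards [hν] with z hz
  have hz' : ‖z - ∫ z, z ∂ν‖ ≤ 2 * R := by
    rw [← dist_eq_norm]
    calc _ ≤ dist z a + dist (∫ z, z ∂ν) a := dist_triangle_right _ _ _
      _ ≤ 2 * R := by linarith [Metric.mem_closedBall.1 hz, Metric.mem_closedBall.1 hm]
  rw [hmean, hmean, ← inner_sub_left, ← inner_sub_left, norm_mul]
  gcongr <;> exact (norm_inner_le_norm _ _).trans (by gcongr)

/-- Popoviciu's inequality on an interval of length `2R‖w‖`. This is the source of the `R²` in the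
final constant. -/
lemma variance_inner_le (hν : ∀ᵐ z ∂ν, z ∈ Metric.closedBall a R) (w : E) :
    Var[fun z => inner ℝ z w; ν] ≤ R ^ 2 * ‖w‖ ^ 2 := by
  refine (variance_le_sq_of_bounded (a := inner ℝ a w - R * ‖w‖) (b := inner ℝ a w + R * ‖w‖) ?_
    ?_).trans (le_of_eq (by ring))
  · filter_upwards [hν] with z hz
    have h1 : |inner ℝ z w - inner ℝ a w| ≤ R * ‖w‖ := by
      rw [← inner_sub_left]
      refine (abs_real_inner_le_norm _ _).trans ?_
      gcongr
      simpa [dist_eq_norm] using hz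
    rw [abs_le] at h1
    constructor <;> linarith
  · have : Continuous fun z : E => inner ℝ z w := by fun_prop
    exact this.aemeasurable

lemma lipschitz_tiltedMean (hν : ∀ᵐ z ∂ν, z ∈ Metric.closedBall a R) (s : ℝ) (x y : E) :
    ‖tiltedMean ν s x - tiltedMean ν s y‖ ≤ |s| * (2 * R) ^ 2 * ‖x - y‖ := by
  have hR := radius_nonneg_of_ae_mem_closedBall hν
  -- Pairing with the difference `D` itself makes the increment `‖D‖²`; one factor `‖D‖` is
  -- cancelled at the end.
  set D := tiltedMean ν s x - tiltedMean ν s y with hD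
  have h := norm_image_sub_le_of_norm_deriv_le_segment_01'
    (f := fun τ : ℝ => inner ℝ (tiltedMean ν s (y + τ • (x - y))) D)
    (C := |s| * ((2 * R * ‖D‖) * (2 * R * ‖x - y‖)))
    (fun τ _ => (hasDerivAt_inner_tiltedMean_line hν s y (x - y) D τ).hasDerivWithinAt)
    (fun τ _ => by
      have := isProbabilityMeasure_tilted_shiftExponent hν s (y + τ • (x - y))
      rw [norm_mul, Real.norm_eq_abs, Real.norm_eq_abs]
      gcongr
      exact abs_covariance_inner_le (ae_tilted_mem_closedBall hν s _) _ _)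
  simp only [one_smul, add_sub_cancel, zero_smul, add_zero, ← inner_sub_left, ← hD,
    real_inner_self_eq_norm_sq, norm_pow, norm_norm] at h
  rcases (norm_nonneg D).eq_or_lt with h0 | h0
  · rw [← h0]; positivity
  · refine le_of_mul_le_mul_left ?_ h0
    linarith

/-- By the mean value theorem along the segment, the pairing is `s` times a variance in the
direction `x - y`. -/
lemma inner_tiltedMean_sub_mem_Icc (hν : ∀ᵐ z ∂ν, z ∈ Metric.closedBall a R) {s : ℝ} (hs : 0 ≤ s)
    (x y : E) :
    inner ℝ (tiltedMean ν s x - tiltedMean ν s y) (x - y) ∈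
      Set.Icc 0 (s * R ^ 2 * ‖x - y‖ ^ 2) := by
  set w := x - y with hw
  have hder := hasDerivAt_inner_tiltedMean_line hν s y w w
  have hself : ∀ τ : ℝ, cov[fun z => inner ℝ z w, fun z => inner ℝ z w;
      ν.tilted (shiftExponent s (y + τ • w))] =
      Var[fun z => inner ℝ z w; ν.tilted (shiftExponent s (y + τ • w))] := fun τ => by
    have : Continuous fun z : E => inner ℝ z w := by fun_prop
    exact covariance_self this.aemeasurable
  have hval : inner ℝ (tiltedMean ν s x - tiltedMean ν s y) w =
      inner ℝ (tiltedMean ν s (y + (1 : ℝ) • w)) w -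
        inner ℝ (tiltedMean ν s (y + (0 : ℝ) • w)) w := by
    rw [← inner_sub_left]
    simp [hw]
  rw [hval]
  obtain ⟨τ, -, hτ⟩ := exists_hasDerivAt_eq_slope
    (fun τ : ℝ => inner ℝ (tiltedMean ν s (y + τ • w)) w) _ one_pos
    (fun τ _ => (hder τ).continuousAt.continuousWithinAt) (fun τ _ => hder τ)
  have := isProbabilityMeasure_tilted_shiftExponent hν s (y + τ • w)
  rw [sub_zero, div_one] at hτ
  rw [← hτ, hself, mul_assoc]
  exact ⟨mul_nonneg hs (variance_nonneg _ _), by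
    gcongr
    exact variance_inner_le (ae_tilted_mem_closedBall hν s _) w⟩

end TiltedMean

/-! ### The flow of the tilted mean on the time interval [0, 1] -/

section TiltedFlow

variable {E : Type*} [NormedAddCommGroup E] [InnerProductSpace ℝ E] [FiniteDimensional ℝ E]
  [MeasurableSpace E] [BorelSpace E]

/-- `X` is a trajectory of the field `tiltedMean ν` on the time interval `[α, β]`. -/
structure IsTiltedTrajectory (ν : Measure E) (X : ℝ → E) (α β : ℝ) : Prop where
  continuousOn : ContinuousOn X (Set.Icc α β)
  hasDerivAt : ∀ s ∈ Set.Ioo α β, HasDerivAt X (tiltedMean ν s (X s)) s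

variable {ν : Measure E} [IsProbabilityMeasure ν] {a : E} {R : ℝ}

lemma IsTiltedTrajectory.mono {X : ℝ → E} {α β α' β' : ℝ} (hX : IsTiltedTrajectory ν X α β)
    (hα : α ≤ α') (hβ : β' ≤ β) : IsTiltedTrajectory ν X α' β' where
  continuousOn := hX.continuousOn.mono (Set.Icc_subset_Icc hα hβ)
  hasDerivAt s hs := hX.hasDerivAt s (Set.Ioo_subset_Ioo hα hβ hs)

lemma IsTiltedTrajectory.hasDerivAt_norm_sub_sq {X Y : ℝ → E} {α β : ℝ}
    (hX : IsTiltedTrajectory ν X α β) (hY : IsTiltedTrajectory ν Y α β) {s : ℝ}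
    (hs : s ∈ Set.Ioo α β) :
    HasDerivAt (fun s => ‖X s - Y s‖ ^ 2)
      (2 * inner ℝ (tiltedMean ν s (X s) - tiltedMean ν s (Y s)) (X s - Y s)) s := by
  have h := ((hX.hasDerivAt s hs).sub (hY.hasDerivAt s hs)).norm_sq
  rw [real_inner_comm] at h
  exact h

lemma IsTiltedTrajectory.monotoneOn_norm_sub_sq (hν : ∀ᵐ z ∂ν, z ∈ Metric.closedBall a R)
    {X Y : ℝ → E} {α β : ℝ} (hα : 0 ≤ α) (hX : IsTiltedTrajectory ν X α β)
    (hY : IsTiltedTrajectory ν Y α β) :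
    MonotoneOn (fun s => ‖X s - Y s‖ ^ 2) (Set.Icc α β) := by
  have hd := fun s hs => hX.hasDerivAt_norm_sub_sq hY (s := s) hs
  refine monotoneOn_of_deriv_nonneg (convex_Icc α β)
    ((hX.continuousOn.sub hY.continuousOn).norm.pow 2) ?_ ?_ <;> rw [interior_Icc]
  · exact fun s hs => (hd s hs).differentiableAt.differentiableWithinAt
  · intro s hs
    rw [(hd s hs).deriv]
    have := (inner_tiltedMean_sub_mem_Icc hν (hα.trans hs.1.le) (X s) (Y s)).1
    positivity

/-- Grönwall with integrating factor: the squared distance has derivative at most `2 s R²` times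
itself, and `∫ 2 s R² ds = R² s²`. -/
lemma IsTiltedTrajectory.antitoneOn_norm_sub_sq_mul_exp
    (hν : ∀ᵐ z ∂ν, z ∈ Metric.closedBall a R)
    {X Y : ℝ → E} {α β : ℝ} (hα : 0 ≤ α) (hX : IsTiltedTrajectory ν X α β)
    (hY : IsTiltedTrajectory ν Y α β) :
    AntitoneOn (fun s => ‖X s - Y s‖ ^ 2 * Real.exp (-(R ^ 2 * s ^ 2))) (Set.Icc α β) := by
  have hd : ∀ s ∈ Set.Ioo α β,
      HasDerivAt (fun s => ‖X s - Y s‖ ^ 2 * Real.exp (-(R ^ 2 * s ^ 2))) _ s := fun s hs =>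
    (hX.hasDerivAt_norm_sub_sq hY hs).mul
      (((hasDerivAt_pow 2 s).const_mul (R ^ 2)).neg.exp)
  refine antitoneOn_of_deriv_nonpos (convex_Icc α β)
    (((hX.continuousOn.sub hY.continuousOn).norm.pow 2).mul (by fun_prop)) ?_ ?_ <;>
    rw [interior_Icc]
  · exact fun s hs => (hd s hs).differentiableAt.differentiableWithinAt
  · intro s hs
    rw [(hd s hs).deriv]
    have h := (inner_tiltedMean_sub_mem_Icc hν (hα.trans hs.1.le) (X s) (Y s)).2
    have he := Real.exp_pos (-(R ^ 2 * s ^ 2))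
    have : (2 * inner ℝ (tiltedMean ν s (X s) - tiltedMean ν s (Y s)) (X s - Y s) -
        2 * (s * R ^ 2 * ‖X s - Y s‖ ^ 2)) * Real.exp (-(R ^ 2 * s ^ 2)) ≤ 0 :=
      mul_nonpos_of_nonpos_of_nonneg (by linarith) he.le
    refine le_trans (le_of_eq ?_) this
    simp
    ring

/-- Monotonicity of the distance gives uniqueness backwards in time, the Grönwall bound gives it
forwards. -/
lemma IsTiltedTrajectory.eqOn (hν : ∀ᵐ z ∂ν, z ∈ Metric.closedBall a R)
    {X Y : ℝ → E} {α β s₀ : ℝ} (hα : 0 ≤ α) (hX : IsTiltedTrajectory ν X α β)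
    (hY : IsTiltedTrajectory ν Y α β) (hs₀ : s₀ ∈ Set.Icc α β) (h : X s₀ = Y s₀) :
    Set.EqOn X Y (Set.Icc α β) := by
  intro s hs
  rw [← sub_eq_zero, ← norm_eq_zero, ← sq_eq_zero_iff]
  rcases le_total s s₀ with hle | hle
  · have := hX.monotoneOn_norm_sub_sq hν hα hY hs hs₀ hle
    simp only [h, sub_self, norm_zero] at this
    exact le_antisymm (by simpa using this) (by positivity)
  · have := hX.antitoneOn_norm_sub_sq_mul_exp hν hα hY hs₀ hs hle
    simp only [h, sub_self, norm_zero] at this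
    have he := Real.exp_pos (-(R ^ 2 * s ^ 2))
    refine le_antisymm ?_ (by positivity)
    by_contra! hlt
    have := mul_pos hlt he
    norm_num at *
    linarith

lemma exists_tiltedTrajectory (hν : ∀ᵐ z ∂ν, z ∈ Metric.closedBall a R) {s₀ : ℝ}
    (hs₀ : s₀ ∈ Set.Icc (0 : ℝ) 1) (x : E) :
    ∃ X : ℝ → E, X s₀ = x ∧ ∀ s ∈ Set.Icc (0 : ℝ) 1,
      HasDerivWithinAt X (tiltedMean ν s (X s)) (Set.Icc 0 1) s := by
  have hR := radius_nonneg_of_ae_mem_closedBall hν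
  have hK : 0 ≤ ‖a‖ + R := by positivity
  -- The field is bounded by `‖a‖ + R` and the time span is at most `1`, so a ball of radius `‖a‖ +
  -- R` traps the solution on all of `[0, 1]`.
  have hpl : IsPicardLindelof (fun s x => tiltedMean ν s x) (⟨s₀, hs₀⟩ : Set.Icc (0 : ℝ) 1) x
      ⟨‖a‖ + R, hK⟩ 0 ⟨‖a‖ + R, hK⟩ ⟨(2 * R) ^ 2, by positivity⟩ := by
    refine ⟨fun s hs => LipschitzWith.lipschitzOnWith ?_, fun x _ => ?_,
      fun s _ x _ => norm_tiltedMean_le hν s x, ?_⟩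
    · refine LipschitzWith.of_dist_le_mul fun x y => ?_
      rw [dist_eq_norm, dist_eq_norm]
      refine (lipschitz_tiltedMean hν s x y).trans ?_
      have : |s| ≤ 1 := abs_le.2 ⟨by linarith [hs.1], hs.2⟩
      have h2 : |s| * (2 * R) ^ 2 ≤ 1 * (2 * R) ^ 2 := by gcongr
      rw [one_mul] at h2
      exact mul_le_mul_of_nonneg_right h2 (norm_nonneg _)
    · exact ((continuous_tiltedMean hν).comp (.prodMk_left x)).continuousOn
    · simp only [NNReal.coe_zero, sub_zero]
      exact mul_le_of_le_one_right hK (max_le (by linarith [hs₀.1]) hs₀.2)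
  exact hpl.exists_eq_forall_mem_Icc_hasDerivWithinAt₀

open Classical in
/-- `tiltedFlow ν s₀ x` is the trajectory on `[0, 1]` of the field `tiltedMean ν` that passes
through `x` at time `s₀`. -/
def tiltedFlow (ν : Measure E) (s₀ : ℝ) (x : E) : ℝ → E :=
  if h : ∃ X : ℝ → E, X s₀ = x ∧ ∀ s ∈ Set.Icc (0 : ℝ) 1,
    HasDerivWithinAt X (tiltedMean ν s (X s)) (Set.Icc 0 1) s then h.choose else 0

section

variable (hν : ∀ᵐ z ∂ν, z ∈ Metric.closedBall a R)
include hν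

lemma tiltedFlow_self {s₀ : ℝ} (hs₀ : s₀ ∈ Set.Icc (0 : ℝ) 1) (x : E) :
    tiltedFlow ν s₀ x s₀ = x := by
  rw [tiltedFlow, dif_pos (exists_tiltedTrajectory hν hs₀ x)]
  exact (exists_tiltedTrajectory hν hs₀ x).choose_spec.1

lemma hasDerivWithinAt_tiltedFlow {s₀ : ℝ} (hs₀ : s₀ ∈ Set.Icc (0 : ℝ) 1) (x : E) {s : ℝ}
    (hs : s ∈ Set.Icc (0 : ℝ) 1) :
    HasDerivWithinAt (tiltedFlow ν s₀ x) (tiltedMean ν s (tiltedFlow ν s₀ x s))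
      (Set.Icc 0 1) s := by
  rw [tiltedFlow, dif_pos (exists_tiltedTrajectory hν hs₀ x)]
  exact (exists_tiltedTrajectory hν hs₀ x).choose_spec.2 s hs

lemma isTiltedTrajectory_tiltedFlow {s₀ : ℝ} (hs₀ : s₀ ∈ Set.Icc (0 : ℝ) 1) (x : E) :
    IsTiltedTrajectory ν (tiltedFlow ν s₀ x) 0 1 where
  continuousOn s hs := (hasDerivWithinAt_tiltedFlow hν hs₀ x hs).continuousWithinAt
  hasDerivAt s hs := (hasDerivWithinAt_tiltedFlow hν hs₀ x (Set.Ioo_subset_Icc_self hs)).hasDerivAt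
    (Icc_mem_nhds hs.1 hs.2)

lemma IsTiltedTrajectory.eq_tiltedFlow {X : ℝ → E} {α β s₀ s : ℝ}
    (hX : IsTiltedTrajectory ν X α β) (hα : 0 ≤ α) (hβ : β ≤ 1)
    (hs₀ : s₀ ∈ Set.Icc α β) (hs : s ∈ Set.Icc α β) : X s = tiltedFlow ν s₀ (X s₀) s := by
  have hs₀' : s₀ ∈ Set.Icc (0 : ℝ) 1 := Set.Icc_subset_Icc hα hβ hs₀
  exact hX.eqOn hν hα ((isTiltedTrajectory_tiltedFlow hν hs₀' (X s₀)).mono hα hβ) hs₀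
    (tiltedFlow_self hν hs₀' _).symm hs

lemma tiltedFlow_tiltedFlow {s₀ s₁ s₂ : ℝ} (h₀ : s₀ ∈ Set.Icc (0 : ℝ) 1)
    (h₁ : s₁ ∈ Set.Icc (0 : ℝ) 1) (h₂ : s₂ ∈ Set.Icc (0 : ℝ) 1) (x : E) :
    tiltedFlow ν s₁ (tiltedFlow ν s₀ x s₁) s₂ = tiltedFlow ν s₀ x s₂ :=
  ((isTiltedTrajectory_tiltedFlow hν h₀ x).eq_tiltedFlow hν le_rfl le_rfl h₁ h₂).symm

lemma norm_tiltedFlow_sub_tiltedFlow_le {s₀ s : ℝ} (h₀ : 0 ≤ s₀) (h : s₀ ≤ s) (h₁ : s ≤ 1)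
    (x y : E) :
    ‖tiltedFlow ν s₀ x s - tiltedFlow ν s₀ y s‖ ≤ Real.exp (R ^ 2 / 2) * ‖x - y‖ := by
  have hs₀ : s₀ ∈ Set.Icc (0 : ℝ) 1 := ⟨h₀, h.trans h₁⟩
  have hs : s ∈ Set.Icc (0 : ℝ) 1 := ⟨h₀.trans h, h₁⟩
  have hanti := (isTiltedTrajectory_tiltedFlow hν hs₀ x).antitoneOn_norm_sub_sq_mul_exp hν le_rfl
    (isTiltedTrajectory_tiltedFlow hν hs₀ y) hs₀ hs h
  simp only [tiltedFlow_self hν hs₀] at hanti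
  refine le_of_sq_le_sq ?_ (by positivity)
  have e1 : Real.exp (-(R ^ 2 * s₀ ^ 2)) ≤ 1 := by
    rw [Real.exp_le_one_iff, neg_nonpos]; positivity
  have e2 : Real.exp (-R ^ 2) ≤ Real.exp (-(R ^ 2 * s ^ 2)) := by
    rw [Real.exp_le_exp, neg_le_neg_iff]
    exact mul_le_of_le_one_right (sq_nonneg _) (pow_le_one₀ hs.1 hs.2)
  have e3 : Real.exp (R ^ 2 / 2) ^ 2 * Real.exp (-R ^ 2) = 1 := by
    rw [← Real.exp_nat_mul, ← Real.exp_add, Real.exp_eq_one_iff]; push_cast; ring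
  have e4 : ‖tiltedFlow ν s₀ x s - tiltedFlow ν s₀ y s‖ ^ 2 * Real.exp (-R ^ 2) ≤
      ‖x - y‖ ^ 2 := by
    calc _ ≤ ‖tiltedFlow ν s₀ x s - tiltedFlow ν s₀ y s‖ ^ 2 * Real.exp (-(R ^ 2 * s ^ 2)) := by
          gcongr
      _ ≤ ‖x - y‖ ^ 2 * Real.exp (-(R ^ 2 * s₀ ^ 2)) := hanti
      _ ≤ ‖x - y‖ ^ 2 * 1 := by gcongr
      _ = _ := mul_one _
  calc ‖tiltedFlow ν s₀ x s - tiltedFlow ν s₀ y s‖ ^ 2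
      = Real.exp (R ^ 2 / 2) ^ 2 *
        (‖tiltedFlow ν s₀ x s - tiltedFlow ν s₀ y s‖ ^ 2 * Real.exp (-R ^ 2)) := by
        rw [mul_left_comm, e3, mul_one]
    _ ≤ Real.exp (R ^ 2 / 2) ^ 2 * ‖x - y‖ ^ 2 := by gcongr
    _ = _ := by ring

lemma norm_tiltedFlow_sub_le {s₀ s : ℝ} (h₀ : s₀ ∈ Set.Icc (0 : ℝ) 1)
    (hs : s ∈ Set.Icc (0 : ℝ) 1) (x : E) :
    ‖tiltedFlow ν s₀ x s - x‖ ≤ (‖a‖ + R) * |s - s₀| := by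
  have := (convex_Icc (0 : ℝ) 1).norm_image_sub_le_of_norm_hasDerivWithin_le
    (fun _ hs => hasDerivWithinAt_tiltedFlow hν h₀ x hs)
    (fun _ _ => norm_tiltedMean_le hν _ _) h₀ hs
  rwa [tiltedFlow_self hν h₀, Real.norm_eq_abs] at this

/-- Flow `x` from `s` to `s'`, which moves it by at most `(‖a‖ + R)|s - s'|`, then compare two
trajectories issued at the same time `s'`. -/
lemma norm_tiltedFlow_one_sub_tiltedFlow_one_le {s s' : ℝ} (hs : s ∈ Set.Icc (0 : ℝ) 1)
    (hs' : s' ∈ Set.Icc (0 : ℝ) 1) (x y : E) :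
    ‖tiltedFlow ν s x 1 - tiltedFlow ν s' y 1‖ ≤
      Real.exp (R ^ 2 / 2) * ((‖a‖ + R) * |s - s'| + ‖x - y‖) := by
  rw [← tiltedFlow_tiltedFlow hν hs hs' ⟨zero_le_one, le_rfl⟩ x]
  refine (norm_tiltedFlow_sub_tiltedFlow_le hν hs'.1 hs'.2 le_rfl _ _).trans ?_
  gcongr
  calc ‖tiltedFlow ν s x s' - y‖ ≤ ‖tiltedFlow ν s x s' - x‖ + ‖x - y‖ :=
        norm_sub_le_norm_sub_add_norm_sub _ _ _
    _ ≤ _ := by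
      gcongr
      rw [abs_sub_comm]
      exact norm_tiltedFlow_sub_le hν hs hs' x

lemma tendsto_tiltedFlow_exp_neg (x : E) :
    Tendsto (fun t : ℝ => tiltedFlow ν (Real.exp (-t)) x 1) atTop (𝓝 (tiltedFlow ν 0 x 1)) := by
  rw [tendsto_iff_norm_sub_tendsto_zero]
  have hlim : Tendsto (fun t : ℝ => Real.exp (R ^ 2 / 2) *
      ((‖a‖ + R) * |Real.exp (-t) - 0| + ‖x - x‖)) atTop (𝓝 0) := by
    have h1 : Tendsto (fun t : ℝ => Real.exp (-t)) atTop (𝓝 0) :=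
      Real.tendsto_exp_neg_atTop_nhds_zero
    have h2 := (((h1.sub_const 0).abs.const_mul (‖a‖ + R)).add_const ‖x - x‖).const_mul
      (Real.exp (R ^ 2 / 2))
    simpa using h2
  refine squeeze_zero' (.of_forall fun _ => norm_nonneg _) ?_ hlim
  filter_upwards [eventually_ge_atTop 0] with t ht
  exact norm_tiltedFlow_one_sub_tiltedFlow_one_le hν
    ⟨(Real.exp_pos _).le, Real.exp_le_one_iff.2 (by linarith)⟩ ⟨le_rfl, zero_le_one⟩ x x

end

end TiltedFlow

/-! ### Density and translations of the standard Gaussian -/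

section StdGaussian

variable {E : Type*} [NormedAddCommGroup E] [InnerProductSpace ℝ E] [FiniteDimensional ℝ E]
  [MeasurableSpace E] [BorelSpace E]

/-- The density of the standard Gaussian measure with respect to the Lebesgue measure. -/
def stdGaussianPDF (x : E) : ℝ :=
  ((2 * Real.pi) ^ (Module.finrank ℝ E / 2 : ℝ))⁻¹ * Real.exp (-(1 / 2) * ‖x‖ ^ 2)

lemma stdGaussianPDF_pos (x : E) : 0 < stdGaussianPDF x := by
  unfold stdGaussianPDF; positivity

@[fun_prop]
lemma continuous_stdGaussianPDF : Continuous (stdGaussianPDF : E → ℝ) := by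
  unfold stdGaussianPDF; fun_prop

lemma integral_stdGaussianPDF : ∫ x : E, stdGaussianPDF x = 1 := by
  unfold stdGaussianPDF
  rw [integral_const_mul, GaussianFourier.integral_rexp_neg_mul_sq_norm (by norm_num)]
  rw [show Real.pi / (1 / 2) = 2 * Real.pi by ring]
  exact inv_mul_cancel₀ (by positivity)

lemma integrable_stdGaussianPDF : Integrable (stdGaussianPDF : E → ℝ) :=
  .of_integral_ne_zero (by rw [integral_stdGaussianPDF]; exact one_ne_zero)

lemma stdGaussian_eq_withDensity :
    stdGaussian E = volume.withDensity fun x => ENNReal.ofReal (stdGaussianPDF x) := by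
  have : IsFiniteMeasure ((volume : Measure E).withDensity
      fun x => ENNReal.ofReal (stdGaussianPDF x)) :=
    isFiniteMeasure_withDensity_ofReal integrable_stdGaussianPDF.2
  apply Measure.ext_of_charFun
  ext t
  rw [charFun_stdGaussian, charFun_apply, integral_withDensity_eq_integral_toReal_smul
    (by fun_prop) (by simp)]
  have h := GaussianFourier.integral_cexp_neg_mul_sq_norm_add (V := E) (b := 1 / 2) (by norm_num)
    Complex.I t
  have hpi : ((2 * Real.pi : ℝ) : ℂ) ^ ((Module.finrank ℝ E / 2 : ℝ) : ℂ) ≠ 0 := by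
    rw [← Complex.ofReal_cpow (by positivity)]
    exact_mod_cast (by positivity : (0 : ℝ) < (2 * Real.pi) ^ (Module.finrank ℝ E / 2 : ℝ)).ne'
  have h2 : ∀ x : E, (ENNReal.ofReal (stdGaussianPDF x)).toReal •
      Complex.exp (inner ℝ x t * Complex.I) =
      (((2 * Real.pi : ℝ) : ℂ) ^ ((Module.finrank ℝ E / 2 : ℝ) : ℂ))⁻¹ *
        Complex.exp (-(1 / 2) * (‖x‖ : ℂ) ^ 2 + Complex.I * (inner ℝ t x : ℝ)) := by
    intro x
    rw [ENNReal.toReal_ofReal (stdGaussianPDF_pos x).le, stdGaussianPDF, Complex.real_smul,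
      Complex.ofReal_mul, Complex.ofReal_inv, Complex.ofReal_cpow (by positivity), mul_assoc,
      Complex.ofReal_exp, ← Complex.exp_add, real_inner_comm]
    push_cast
    ring_nf
  simp_rw [h2]
  rw [integral_const_mul, h]
  have h3 : (Real.pi / (1 / 2) : ℂ) ^ (Module.finrank ℝ E / 2 : ℂ) =
      ((2 * Real.pi : ℝ) : ℂ) ^ ((Module.finrank ℝ E / 2 : ℝ) : ℂ) := by
    push_cast
    congr 1
    ring
  rw [h3, ← mul_assoc, inv_mul_cancel₀ hpi, one_mul]
  congr 1
  rw [Complex.I_sq]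
  ring

lemma stdGaussian_absolutelyContinuous_volume : stdGaussian E ≪ volume := by
  rw [stdGaussian_eq_withDensity]
  exact withDensity_absolutelyContinuous _ _

lemma volume_absolutelyContinuous_stdGaussian : (volume : Measure E) ≪ stdGaussian E := by
  rw [stdGaussian_eq_withDensity]
  refine withDensity_absolutelyContinuous' (by fun_prop) (.of_forall fun x => ?_)
  simpa using stdGaussianPDF_pos x

/-- Cameron–Martin formula in finite dimension, by translating Lebesgue measure. -/
lemma map_smul_add_stdGaussian (s : ℝ) (z : E) :
    (stdGaussian E).map (fun y => s • z + y) =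
      (stdGaussian E).withDensity fun x => ENNReal.ofReal (Real.exp (shiftExponent s x z)) := by
  ext A hA
  rw [Measure.map_apply (by fun_prop) hA, withDensity_apply _ hA, stdGaussian_eq_withDensity,
    withDensity_apply _ (hA.preimage (by fun_prop)), restrict_withDensity hA,
    lintegral_withDensity_eq_lintegral_mul _ (by fun_prop) (by fun_prop),
    ← lintegral_indicator hA, ← lintegral_indicator (hA.preimage (by fun_prop)),
    ← lintegral_sub_right_eq_self _ (s • z)]
  congr 1 with x
  have hmem : x - s • z ∈ (fun y => s • z + y) ⁻¹' A ↔ x ∈ A := by simp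
  by_cases hx : x ∈ A
  · rw [Set.indicator_of_mem (hmem.2 hx), Set.indicator_of_mem hx, Pi.mul_apply]
    rw [← ENNReal.ofReal_mul (stdGaussianPDF_pos x).le]
    congr 1
    rw [stdGaussianPDF, stdGaussianPDF, mul_assoc, ← Real.exp_add, shiftExponent,
      norm_sub_sq_real, norm_smul, inner_smul_right, mul_pow, Real.norm_eq_abs, sq_abs]
    ring_nf
  · rw [Set.indicator_of_notMem (hmem.not.2 hx), Set.indicator_of_notMem hx]

lemma integral_comp_smul_add_stdGaussian (s : ℝ) (z : E) (h : E → ℝ) :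
    ∫ y, h (s • z + y) ∂(stdGaussian E) =
      ∫ x, Real.exp (shiftExponent s x z) * h x ∂(stdGaussian E) := by
  have hm : MeasurableEmbedding fun y : E => s • z + y := measurableEmbedding_addLeft _
  rw [← hm.integral_map, map_smul_add_stdGaussian,
    integral_withDensity_eq_integral_toReal_smul (by fun_prop) (by simp)]
  simp_rw [ENNReal.toReal_ofReal (Real.exp_pos _).le, smul_eq_mul]

lemma integrable_exp_shiftExponent_stdGaussian (s : ℝ) (z : E) :
    Integrable (fun x => Real.exp (shiftExponent s x z)) (stdGaussian E) :=
  .of_integral_ne_zero (by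
    have := integral_comp_smul_add_stdGaussian s z fun _ => 1
    simp only [mul_one] at this
    rw [← this]
    simp)

lemma integral_exp_shiftExponent_stdGaussian (s : ℝ) (z : E) :
    ∫ x, Real.exp (shiftExponent s x z) ∂(stdGaussian E) = 1 := by
  simpa using (integral_comp_smul_add_stdGaussian s z fun _ => 1).symm

/-- Needed because the density of `μ` is known only almost everywhere; for `σ ≠ 0` null sets pull
back to null sets. -/
lemma quasiMeasurePreserving_add_smul_stdGaussian (x : E) {σ : ℝ} (hσ : σ ≠ 0) :
    Measure.QuasiMeasurePreserving (fun y : E => x + σ • y) (stdGaussian E) (stdGaussian E) := by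
  have h1 : Measure.QuasiMeasurePreserving (fun y : E => σ • y) volume volume := by
    refine ⟨by fun_prop, ?_⟩
    rw [Measure.map_addHaar_smul _ hσ]
    exact Measure.smul_absolutelyContinuous
  have h2 : Measure.QuasiMeasurePreserving (fun y : E => x + y) volume volume :=
    (measurePreserving_add_left volume x).quasiMeasurePreserving
  exact (h2.comp h1).mono stdGaussian_absolutelyContinuous_volume
    volume_absolutelyContinuous_stdGaussian

end StdGaussian

/-! ### The Ornstein–Uhlenbeck field as a tilted mean -/

section HeatFlowField

variable {E : Type*} [NormedAddCommGroup E] [InnerProductSpace ℝ E] [FiniteDimensional ℝ E]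
  [MeasurableSpace E] [BorelSpace E] {ν : Measure E} [IsProbabilityMeasure ν] {a : E} {R : ℝ}

lemma stdGaussian_conv_eq_withDensity :
    (stdGaussian E).conv ν = (stdGaussian E).withDensity
      fun x => ∫⁻ z, ENNReal.ofReal (Real.exp (shiftExponent 1 x z)) ∂ν := by
  have hm : Measurable fun p : E × E => ENNReal.ofReal (Real.exp (shiftExponent 1 p.1 p.2)) := by
    have : Continuous fun p : E × E => Real.exp (shiftExponent 1 p.1 p.2) := by fun_prop
    exact this.measurable.ennreal_ofReal
  ext A hA
  rw [withDensity_apply _ hA, lintegral_lintegral_swap hm.aemeasurable, Measure.conv_comm,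
    ← setLIntegral_one, ← lintegral_indicator hA,
    Measure.lintegral_conv (measurable_const.indicator hA)]
  congr 1 with z
  rw [← withDensity_apply _ hA, ← map_smul_add_stdGaussian, Measure.map_apply (by fun_prop) hA,
    ← setLIntegral_one, ← lintegral_indicator (hA.preimage (by fun_prop))]
  simp only [one_smul]
  rfl

lemma rnDeriv_stdGaussian_conv :
    (fun x => (((stdGaussian E).conv ν).rnDeriv (stdGaussian E) x).toReal) =ᵐ[stdGaussian E]
      fun x => ∫ z, Real.exp (shiftExponent 1 x z) ∂ν := by
  have hm : Measurable fun p : E × E => ENNReal.ofReal (Real.exp (shiftExponent 1 p.1 p.2)) := by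
    have : Continuous fun p : E × E => Real.exp (shiftExponent 1 p.1 p.2) := by fun_prop
    exact this.measurable.ennreal_ofReal
  rw [stdGaussian_conv_eq_withDensity]
  filter_upwards [Measure.rnDeriv_withDensity (stdGaussian E) (hm.lintegral_prod_right' (ν := ν))] with x hx
  rw [hx, integral_eq_lintegral_of_nonneg_ae (.of_forall fun z => (Real.exp_pos _).le)]
  have : Continuous fun z : E => Real.exp (shiftExponent 1 x z) := by fun_prop
  exact this.aestronglyMeasurable

/-- Since `c² + σ² = 1`, the exponent splits into a part in `x` and a part in `y`; the latter
integrates to `1`. -/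
lemma integral_ornsteinUhlenbeck_shiftExponent (hν : ∀ᵐ z ∂ν, z ∈ Metric.closedBall a R)
    {c σ : ℝ} (hcσ : c ^ 2 + σ ^ 2 = 1) (x : E) :
    ∫ y, ∫ z, Real.exp (shiftExponent 1 (c • x + σ • y) z) ∂ν ∂(stdGaussian E) =
      ∫ z, Real.exp (shiftExponent c x z) ∂ν := by
  have hpt : ∀ y z : E, Real.exp (shiftExponent 1 (c • x + σ • y) z) =
      Real.exp (shiftExponent c x z) * Real.exp (shiftExponent σ y z) := by
    intro y z
    rw [← Real.exp_add]
    congr 1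
    simp only [shiftExponent, inner_add_left, real_inner_smul_left]
    linear_combination (‖z‖ ^ 2 / 2) * hcσ
  have hz : ∀ z : E, ∫ y, Real.exp (shiftExponent 1 (c • x + σ • y) z) ∂(stdGaussian E) =
      Real.exp (shiftExponent c x z) := by
    intro z
    simp_rw [hpt]
    rw [integral_const_mul, integral_exp_shiftExponent_stdGaussian, mul_one]
  rw [integral_integral_swap]
  · simp_rw [hz]
  · refine (integrable_prod_iff' ?_).2 ⟨.of_forall fun z => ?_, ?_⟩
    · have : Continuous (Function.uncurry fun y z : E =>
          Real.exp (shiftExponent 1 (c • x + σ • y) z)) := by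
        unfold Function.uncurry; fun_prop
      exact this.aestronglyMeasurable
    · simp only [Function.uncurry_apply_pair, hpt]
      exact (integrable_exp_shiftExponent_stdGaussian σ z).const_mul _
    · simp only [Function.uncurry_apply_pair, Real.norm_eq_abs, Real.abs_exp, hz]
      exact Continuous.integrable_of_ae_mem_closedBall (by fun_prop) hν

lemma gradient_log_integral_exp_shiftExponent (hν : ∀ᵐ z ∂ν, z ∈ Metric.closedBall a R)
    (s : ℝ) (x : E) :
    gradient (fun x => Real.log (∫ z, Real.exp (shiftExponent s x z) ∂ν)) x =
      s • tiltedMean ν s x := by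
  have h := hasGradientAt_integral_mul_exp_shiftExponent (h := fun _ => 1) continuous_const hν s x
  simp only [one_mul] at h
  have h2 := h.hasFDerivAt.log (integral_exp_shiftExponent_pos hν s x).ne'
  refine HasGradientAt.gradient (hasGradientAt_iff_hasFDerivAt.2 (h2.congr_fderiv ?_))
  rw [tiltedMean_eq_smul, ← map_smul, smul_comm s, ← integral_smul s]
  simp_rw [smul_smul, mul_comm s]

end HeatFlowField

lemma ouSemigroup_gaussianDensity {d : ℕ} {a : EuclideanSpace ℝ (Fin d)} {R : ℝ}
    {ν : Measure (EuclideanSpace ℝ (Fin d))} [IsProbabilityMeasure ν]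
    (hν : ∀ᵐ z ∂ν, z ∈ Metric.closedBall a R) {t : ℝ} (ht : 0 < t)
    (x : EuclideanSpace ℝ (Fin d)) :
    ouSemigroup t (gaussianDensity ((stdGaussian (EuclideanSpace ℝ (Fin d))).conv ν)) x =
      ∫ z, Real.exp (shiftExponent (Real.exp (-t)) x z) ∂ν := by
  have hlt : Real.exp (-2 * t) < 1 := Real.exp_lt_one_iff.2 (by linarith)
  have hσ : √(1 - Real.exp (-2 * t)) ≠ 0 := (Real.sqrt_pos.2 (by linarith)).ne'
  have hcσ : Real.exp (-t) ^ 2 + √(1 - Real.exp (-2 * t)) ^ 2 = 1 := by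
    rw [Real.sq_sqrt (by linarith), ← Real.exp_nat_mul]
    push_cast
    ring_nf
  rw [ouSemigroup, ← integral_ornsteinUhlenbeck_shiftExponent hν hcσ]
  exact integral_congr_ae ((quasiMeasurePreserving_add_smul_stdGaussian
    (Real.exp (-t) • x) hσ).ae_eq_comp rnDeriv_stdGaussian_conv)

lemma heatFlowField_eq {d : ℕ} {a : EuclideanSpace ℝ (Fin d)} {R : ℝ}
    {ν : Measure (EuclideanSpace ℝ (Fin d))} [IsProbabilityMeasure ν]
    (hν : ∀ᵐ z ∂ν, z ∈ Metric.closedBall a R) {t : ℝ} (ht : 0 < t)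
    (x : EuclideanSpace ℝ (Fin d)) :
    heatFlowField ((stdGaussian (EuclideanSpace ℝ (Fin d))).conv ν) t x =
      -(Real.exp (-t) • tiltedMean ν (Real.exp (-t)) x) := by
  rw [heatFlowField, ← gradient_log_integral_exp_shiftExponent hν]
  simp_rw [ouSemigroup_gaussianDensity hν ht]

/-! ### Transport of the Gaussian by the flow -/

section Transport

variable {E : Type*} [NormedAddCommGroup E] [InnerProductSpace ℝ E] [FiniteDimensional ℝ E]
  [MeasurableSpace E] [BorelSpace E] {ν : Measure E} [IsProbabilityMeasure ν] {a : E} {R : ℝ}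

lemma integrable_exp_shiftExponent_prod (s : ℝ) :
    Integrable (fun p : E × E => Real.exp (shiftExponent s p.1 p.2))
      ((stdGaussian E).prod ν) := by
  refine (integrable_prod_iff' ?_).2 ⟨.of_forall fun z => ?_, ?_⟩
  · have : Continuous fun p : E × E => Real.exp (shiftExponent s p.1 p.2) := by fun_prop
    exact this.aestronglyMeasurable
  · exact integrable_exp_shiftExponent_stdGaussian s z
  · simp only [Real.norm_eq_abs, Real.abs_exp, integral_exp_shiftExponent_stdGaussian]
    exact integrable_const _

/-- Along the moving frame `y ↦ s • z + y` a Lipschitz function of `(s, x)` is the integral of its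
derivative, for almost every `y`. -/
lemma ae_intervalIntegral_fderiv_eq_sub {U : ℝ × E → ℝ} {C : NNReal} (hU : LipschitzWith C U)
    (z : E) :
    ∀ᵐ y : E, ∫ s in (0 : ℝ)..1, fderiv ℝ U (s, s • z + y) (1, z) = U (1, z + y) - U (0, y) := by
  have hdiff : ∀ᵐ s : ℝ, ∀ᵐ x : E, DifferentiableAt ℝ U (s, x) :=
    Measure.ae_ae_of_ae_prod (hU.ae_differentiableAt
      (μ := (volume : Measure ℝ).prod (volume : Measure E)))
  have hshift : ∀ᵐ s : ℝ, ∀ᵐ y : E, DifferentiableAt ℝ U (s, s • z + y) := by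
    filter_upwards [hdiff] with s hs
    exact (measurePreserving_add_left volume (s • z)).quasiMeasurePreserving.ae hs
  have hmeas : MeasurableSet {p : ℝ × E | DifferentiableAt ℝ U (p.1, p.1 • z + p.2)} :=
    (measurableSet_of_differentiableAt ℝ U).preimage
      (f := fun p : ℝ × E => (p.1, p.1 • z + p.2)) (by fun_prop)
  -- Rademacher gives differentiability for almost every `x` at almost every `s`; translation by `s
  -- • z` and Fubini turn this into almost every `s` for almost every `y`.
  filter_upwards [(Measure.ae_ae_comm hmeas).1 hshift] with y hy
  have hlip : LipschitzOnWith (C * (1 + ‖z‖₊)) (fun s : ℝ => U (s, s • z + y))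
      (Set.uIcc 0 1) := by
    refine LipschitzWith.lipschitzOnWith (hU.comp (LipschitzWith.of_dist_le_mul fun s t => ?_))
    rw [Prod.dist_eq, dist_add_right, dist_eq_norm (s • z), ← sub_smul, norm_smul]
    push_cast
    rw [dist_eq_norm]
    have h0 := norm_nonneg (s - t)
    have h1 := norm_nonneg z
    exact max_le (by nlinarith) (by nlinarith)
  have hftc := hlip.absolutelyContinuousOnInterval.integral_deriv_eq_sub
  simp only [one_smul, zero_smul, zero_add] at hftc
  rw [← hftc]
  refine intervalIntegral.integral_congr_ae ?_
  filter_upwards [hy] with s hs _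
  have hline : HasDerivAt (fun s : ℝ => (s, s • z + y)) ((1 : ℝ), z) s := by
    refine (hasDerivAt_id s).prodMk ?_
    simpa using ((hasDerivAt_id s).smul_const z).add_const y
  exact (hs.hasFDerivAt.comp_hasDerivAt s hline).deriv.symm

lemma norm_fderiv_one_apply_le {U : ℝ × E → ℝ} {C : NNReal} (hU : LipschitzWith C U)
    (p : ℝ × E) {z : E} {K : ℝ} (hz : ‖z‖ ≤ K) : ‖fderiv ℝ U p (1, z)‖ ≤ C * max 1 K := by
  refine (ContinuousLinearMap.le_opNorm _ _).trans ?_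
  gcongr
  · exact norm_fderiv_le_of_lipschitz ℝ hU
  · rw [Prod.norm_def, norm_one]
    gcongr

lemma measurable_fderiv_one_apply (U : ℝ × E → ℝ) {X : Type*} [MeasurableSpace X]
    {f : X → ℝ × E} {g : X → E} (hf : Measurable f) (hg : Measurable g) :
    Measurable fun x => fderiv ℝ U (f x) (1, g x) :=
  isBoundedBilinearMap_apply.continuous.measurable.comp
    (((measurable_fderiv ℝ U).comp hf).prodMk (measurable_const.prodMk hg))

/-- If `U` is constant along the trajectories of `tiltedMean ν`, its integral against the law of
`s Z + G` vanishes infinitesimally. -/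
lemma integral_integral_fderiv_eq_zero (hν : ∀ᵐ z ∂ν, z ∈ Metric.closedBall a R)
    {U : ℝ × E → ℝ} {C : NNReal} (hU : LipschitzWith C U) {s : ℝ}
    (hs : ∀ x, fderiv ℝ U (s, x) (1, tiltedMean ν s x) = 0) :
    ∫ z, ∫ y, fderiv ℝ U (s, s • z + y) (1, z) ∂(stdGaussian E) ∂ν = 0 := by
  have hstep : ∀ z : E, ∫ y, fderiv ℝ U (s, s • z + y) (1, z) ∂(stdGaussian E) =
      ∫ x, Real.exp (shiftExponent s x z) * fderiv ℝ U (s, x) (1, z) ∂(stdGaussian E) :=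
    fun z => integral_comp_smul_add_stdGaussian s z fun x => fderiv ℝ U (s, x) (1, z)
  simp_rw [hstep]
  rw [← integral_integral_swap]
  · have hz : ∀ x : E,
        ∫ z, Real.exp (shiftExponent s x z) * fderiv ℝ U (s, x) (1, z) ∂ν = 0 := by
      intro x
      have hint : Integrable (fun z : E => Real.exp (shiftExponent s x z) • ((1 : ℝ), z)) ν :=
        Continuous.integrable_of_ae_mem_closedBall (by fun_prop) hν
      have hmean : ∫ z, Real.exp (shiftExponent s x z) • ((1 : ℝ), z) ∂ν =
          (∫ z, Real.exp (shiftExponent s x z) ∂ν) • ((1 : ℝ), tiltedMean ν s x) := by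
        have h1 : Integrable (fun z : E => Real.exp (shiftExponent s x z)) ν :=
          Continuous.integrable_of_ae_mem_closedBall (by fun_prop) hν
        -- Conditioning on `sZ + G = x`: linearity of the derivative replaces `z` by its conditional
        -- mean.
        have h2 : Integrable (fun z : E => Real.exp (shiftExponent s x z) • z) ν :=
          Continuous.integrable_of_ae_mem_closedBall (by fun_prop) hν
        simp_rw [Prod.smul_mk, smul_eq_mul, mul_one]
        rw [integral_pair h1 h2, tiltedMean_eq_smul,
          smul_inv_smul₀ (integral_exp_shiftExponent_pos hν s x).ne']
      calc ∫ z, Real.exp (shiftExponent s x z) * fderiv ℝ U (s, x) (1, z) ∂ν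
          = ∫ z, fderiv ℝ U (s, x) (Real.exp (shiftExponent s x z) • ((1 : ℝ), z)) ∂ν := by
            simp_rw [map_smul, smul_eq_mul]
        _ = fderiv ℝ U (s, x) (∫ z, Real.exp (shiftExponent s x z) • ((1 : ℝ), z) ∂ν) :=
            (fderiv ℝ U (s, x)).integral_comp_comm hint
        _ = 0 := by rw [hmean, map_smul, hs, smul_zero]
    simp_rw [hz, integral_zero]
  · refine (integrable_exp_shiftExponent_prod s).mul_bdd (c := C * max 1 (‖a‖ + R))
      (measurable_fderiv_one_apply U (by fun_prop) (by fun_prop)).aestronglyMeasurable ?_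
    filter_upwards [Measure.quasiMeasurePreserving_snd.ae (ae_norm_le_of_ae_mem_closedBall hν)]
      with p hp
    exact norm_fderiv_one_apply_le hU _ hp

/-- The frame `s • z + y` moves the law of `G` at `s = 0` to that of `Z + G` at `s = 1`; Fubini
brings the `s`-integral outside, where each slice vanishes. -/
lemma integral_stdGaussian_conv_eq (hν : ∀ᵐ z ∂ν, z ∈ Metric.closedBall a R)
    {U : ℝ × E → ℝ} {C : NNReal} (hU : LipschitzWith C U) {B : ℝ} (hB : ∀ p, ‖U p‖ ≤ B)
    (hs : ∀ s ∈ Set.Ioo (0 : ℝ) 1, ∀ x, fderiv ℝ U (s, x) (1, tiltedMean ν s x) = 0) :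
    ∫ x, U (1, x) ∂((stdGaussian E).conv ν) = ∫ y, U (0, y) ∂(stdGaussian E) := by
  have hUm : Measurable U := hU.continuous.measurable
  have hbdd : ∀ {X : Type _} [MeasurableSpace X] (ρ : Measure X) [IsFiniteMeasure ρ]
      {f : X → ℝ × E} (_ : Measurable f), Integrable (fun x => U (f x)) ρ := fun ρ _ f hf =>
    .of_bound (hUm.comp hf).aestronglyMeasurable B (.of_forall fun x => hB _)
  have hswap : ∀ z : E, ∫ y, (∫ s in Set.Ioc (0 : ℝ) 1,
      fderiv ℝ U (s, s • z + y) (1, z)) ∂(stdGaussian E) =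
      ∫ s in Set.Ioc (0 : ℝ) 1, ∫ y, fderiv ℝ U (s, s • z + y) (1, z) ∂(stdGaussian E) := by
    intro z
    refine integral_integral_swap (.of_bound (measurable_fderiv_one_apply U
      (f := fun p : E × ℝ => (p.2, p.2 • z + p.1)) (by fun_prop)
      measurable_const).aestronglyMeasurable (C * max 1 ‖z‖) (.of_forall fun p => ?_))
    exact norm_fderiv_one_apply_le hU _ le_rfl
  have hdiff : ∀ z : E, ∫ y, U (1, z + y) ∂(stdGaussian E) - ∫ y, U (0, y) ∂(stdGaussian E) =
      ∫ s in Set.Ioc (0 : ℝ) 1, ∫ y, fderiv ℝ U (s, s • z + y) (1, z) ∂(stdGaussian E) := by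
    intro z
    rw [← hswap, ← integral_sub (hbdd _ (by fun_prop)) (hbdd _ (by fun_prop))]
    refine integral_congr_ae ?_
    filter_upwards [stdGaussian_absolutelyContinuous_volume.ae_le
      (ae_intervalIntegral_fderiv_eq_sub hU z)] with y hy
    rw [← hy, intervalIntegral.integral_of_le zero_le_one]
  have hmeas : Measurable fun p : E × ℝ =>
      ∫ y, fderiv ℝ U (p.2, p.2 • p.1 + y) (1, p.1) ∂(stdGaussian E) := by
    have : Measurable fun q : (E × ℝ) × E =>
        fderiv ℝ U (q.1.2, q.1.2 • q.1.1 + q.2) (1, q.1.1) :=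
      measurable_fderiv_one_apply U (by fun_prop) (by fun_prop)
    exact this.stronglyMeasurable.integral_prod_right'.measurable
  rw [Measure.conv_comm, integral_conv (hbdd _ (by fun_prop)), ← sub_eq_zero]
  calc ∫ z, ∫ y, U (1, z + y) ∂(stdGaussian E) ∂ν - ∫ y, U (0, y) ∂(stdGaussian E)
      = ∫ z, (∫ y, U (1, z + y) ∂(stdGaussian E) - ∫ y, U (0, y) ∂(stdGaussian E)) ∂ν := by
        rw [integral_sub _ (integrable_const _)]
        · simp
        · exact (hbdd (ν.prod (stdGaussian E)) (f := fun p => (1, p.1 + p.2))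
            (by fun_prop)).integral_prod_left
    _ = ∫ z, (∫ s in Set.Ioc (0 : ℝ) 1,
          ∫ y, fderiv ℝ U (s, s • z + y) (1, z) ∂(stdGaussian E)) ∂ν := by simp_rw [hdiff]
    _ = ∫ s in Set.Ioc (0 : ℝ) 1, ∫ z,
          ∫ y, fderiv ℝ U (s, s • z + y) (1, z) ∂(stdGaussian E) ∂ν := by
        refine integral_integral_swap (.of_bound hmeas.aestronglyMeasurable
          (C * max 1 (‖a‖ + R)) ?_)
        filter_upwards [Measure.quasiMeasurePreserving_fst.ae
          (ae_norm_le_of_ae_mem_closedBall hν)] with p hp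
        have := norm_integral_le_of_norm_le_const (μ := stdGaussian E)
          (f := fun y => fderiv ℝ U (p.2, p.2 • p.1 + y) (1, p.1))
          (.of_forall fun y => norm_fderiv_one_apply_le hU (p.2, p.2 • p.1 + y) hp)
        rwa [probReal_univ, mul_one] at this
    _ = 0 := by
        rw [integral_Ioc_eq_integral_Ioo]
        refine setIntegral_eq_zero_of_forall_eq_zero fun s h => ?_
        exact integral_integral_fderiv_eq_zero hν hU (hs s h)

/-- Lipschitz test functions transported by the flow up to time `1`. -/
lemma integral_comp_tiltedFlow (hν : ∀ᵐ z ∂ν, z ∈ Metric.closedBall a R) {φ : E → ℝ} {L : NNReal}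
    (hφ : LipschitzWith L φ) {B : ℝ} (hB : ∀ x, ‖φ x‖ ≤ B) :
    ∫ x, φ (tiltedFlow ν 0 x 1) ∂(stdGaussian E) = ∫ x, φ x ∂((stdGaussian E).conv ν) := by
  have hR := radius_nonneg_of_ae_mem_closedBall hν
  have hK : 0 ≤ ‖a‖ + R := by positivity
  have h01 : (0 : ℝ) ≤ 1 := zero_le_one
  -- Time is clamped to `[0, 1]` so that `U` is Lipschitz on the whole product space.
  set c : ℝ → Set.Icc (0 : ℝ) 1 := Set.projIcc 0 1 h01 with hc
  set U : ℝ × E → ℝ := fun p => φ (tiltedFlow ν (c p.1) p.2 1) with hUdef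
  have hflow : LipschitzWith (Real.exp (R ^ 2 / 2) * (‖a‖ + R + 1)).toNNReal
      fun p : ℝ × E => tiltedFlow ν (c p.1) p.2 1 := by
    refine LipschitzWith.of_dist_le_mul fun p q => ?_
    rw [Real.coe_toNNReal _ (by positivity), dist_eq_norm, mul_assoc]
    refine (norm_tiltedFlow_one_sub_tiltedFlow_one_le hν (c p.1).2 (c q.1).2 p.2 q.2).trans ?_
    gcongr
    have h1 : |(c p.1 : ℝ) - c q.1| ≤ dist p q := by
      rw [← Real.dist_eq, ← Subtype.dist_eq]
      refine (((LipschitzWith.projIcc h01).dist_le_mul p.1 q.1).trans ?_)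
      rw [NNReal.coe_one, one_mul]
      exact le_max_left _ _
    have h2 : ‖p.2 - q.2‖ ≤ dist p q := by
      rw [← dist_eq_norm]; exact le_max_right _ _
    rw [add_mul (‖a‖ + R), one_mul]
    gcongr
  have hU : LipschitzWith _ U := hφ.comp hflow
  have hproj : ∀ s ∈ Set.Icc (0 : ℝ) 1, (c s : ℝ) = s := fun s hs => by
    rw [hc, Set.projIcc_of_mem h01 hs]
  have hs : ∀ s ∈ Set.Ioo (0 : ℝ) 1, ∀ x, fderiv ℝ U (s, x) (1, tiltedMean ν s x) = 0 := by
    intro s hs x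
    by_cases hd : DifferentiableAt ℝ U (s, x)
    swap
    -- At points of non-differentiability the default value `0` of `fderiv` makes the identity
    -- trivial.
    · rw [fderiv_zero_of_not_differentiableAt hd]; rfl
    have hsI := Set.Ioo_subset_Icc_self hs
    have hself := tiltedFlow_self hν hsI x
    have hcurve : HasDerivAt (fun τ : ℝ => (τ, tiltedFlow ν s x τ)) ((1 : ℝ), tiltedMean ν s x)
        s := by
      have := (isTiltedTrajectory_tiltedFlow hν hsI x).hasDerivAt s hs
      rw [hself] at this
      exact (hasDerivAt_id s).prodMk this
    have hcomp : HasDerivAt (fun τ : ℝ => U (τ, tiltedFlow ν s x τ))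
        (fderiv ℝ U (s, x) (1, tiltedMean ν s x)) s := by
      have h := hd.hasFDerivAt
      rw [← hself] at h
      have := h.comp_hasDerivAt s hcurve
      rwa [hself] at this
    have hconst : HasDerivAt (fun τ : ℝ => U (τ, tiltedFlow ν s x τ)) 0 s := by
      refine (hasDerivAt_const s (φ (tiltedFlow ν s x 1))).congr_of_eventuallyEq ?_
      filter_upwards [Icc_mem_nhds hs.1 hs.2] with τ hτ
      simp only [hUdef]
      rw [hproj τ hτ, tiltedFlow_tiltedFlow hν hsI hτ ⟨h01, le_rfl⟩]
    exact hcomp.unique hconst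
  have h := integral_stdGaussian_conv_eq hν hU (fun p => hB _) hs
  simp only [hUdef, hproj 0 ⟨le_rfl, h01⟩, hproj 1 ⟨h01, le_rfl⟩,
    tiltedFlow_self hν (s₀ := 1) ⟨h01, le_rfl⟩] at h
  exact h.symm

lemma lipschitzWith_tiltedFlow_zero_one (hν : ∀ᵐ z ∂ν, z ∈ Metric.closedBall a R) :
    LipschitzWith (Real.exp (R ^ 2 / 2)).toNNReal fun x => tiltedFlow ν 0 x 1 := by
  refine LipschitzWith.of_dist_le_mul fun x y => ?_
  rw [Real.coe_toNNReal _ (Real.exp_pos _).le, dist_eq_norm, dist_eq_norm]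
  exact norm_tiltedFlow_sub_tiltedFlow_le hν le_rfl zero_le_one le_rfl x y

/-- The real and imaginary parts of a characteristic function are integrals of bounded Lipschitz
functions, so such test functions determine the law. -/
lemma measurePreserving_tiltedFlow (hν : ∀ᵐ z ∂ν, z ∈ Metric.closedBall a R) :
    MeasurePreserving (fun x => tiltedFlow ν 0 x 1) (stdGaussian E)
      ((stdGaussian E).conv ν) := by
  have hm : Measurable fun x => tiltedFlow ν 0 x 1 :=
    (lipschitzWith_tiltedFlow_zero_one hν).continuous.measurable
  refine ⟨hm, ?_⟩
  have := Measure.isProbabilityMeasure_map (μ := stdGaussian E) hm.aemeasurable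
  have htest : ∀ g : ℝ → ℝ, LipschitzWith 1 g → (∀ r, ‖g r‖ ≤ 1) → ∀ ξ : E,
      ∫ x, g (inner ℝ x ξ) ∂((stdGaussian E).map fun x => tiltedFlow ν 0 x 1) =
        ∫ x, g (inner ℝ x ξ) ∂((stdGaussian E).conv ν) := by
    intro g hg hb ξ
    have hlip : LipschitzWith (1 * ‖ξ‖₊) fun x : E => g (inner ℝ x ξ) := by
      refine hg.comp (LipschitzWith.of_dist_le_mul fun x y => ?_)
      rw [dist_eq_norm, ← inner_sub_left, dist_eq_norm, mul_comm]
      exact norm_inner_le_norm _ _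
    rw [integral_map hm.aemeasurable hlip.continuous.aestronglyMeasurable]
    exact integral_comp_tiltedFlow hν hlip fun x => hb _
  apply Measure.ext_of_charFun
  ext ξ
  have hint : ∀ (ρ : Measure E) [IsFiniteMeasure ρ],
      Integrable (fun x => Complex.exp (inner ℝ x ξ * Complex.I)) ρ := fun ρ _ => by
    refine .of_bound (Continuous.aestronglyMeasurable (by fun_prop)) 1 (.of_forall fun x => ?_)
    rw [Complex.norm_exp_ofReal_mul_I]
  have hre : ∀ (ρ : Measure E) [IsFiniteMeasure ρ],
      (charFun ρ ξ).re = ∫ x, Real.cos (inner ℝ x ξ) ∂ρ := fun ρ _ => by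
    rw [charFun_apply, ← RCLike.re_eq_complex_re, ← integral_re (hint ρ)]
    simp [Complex.exp_ofReal_mul_I_re]
  have him : ∀ (ρ : Measure E) [IsFiniteMeasure ρ],
      (charFun ρ ξ).im = ∫ x, Real.sin (inner ℝ x ξ) ∂ρ := fun ρ _ => by
    rw [charFun_apply, ← RCLike.im_eq_complex_im, ← integral_im (hint ρ)]
    simp [Complex.exp_ofReal_mul_I_im]
  apply Complex.ext
  · rw [hre, hre]
    exact htest Real.cos (lipschitzWith_of_nnnorm_deriv_le Real.differentiable_cos fun r => by
      simpa [← NNReal.coe_le_coe] using Real.abs_sin_le_one r) Real.abs_cos_le_one ξ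
  · rw [him, him]
    exact htest Real.sin (lipschitzWith_of_nnnorm_deriv_le Real.differentiable_sin fun r => by
      simpa [← NNReal.coe_le_coe] using Real.abs_cos_le_one r) Real.abs_sin_le_one ξ

end Transport

/-! ### Back to heat-flow time: existence and uniqueness of the Kim–Milman map -/

section KimMilman

variable {d : ℕ} {ν : Measure (EuclideanSpace ℝ (Fin d))} [IsProbabilityMeasure ν]
  {a : EuclideanSpace ℝ (Fin d)} {R : ℝ}

lemma exp_neg_mem_Icc {t : ℝ} (ht : 0 ≤ t) : Real.exp (-t) ∈ Set.Icc (0 : ℝ) 1 :=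
  ⟨(Real.exp_pos _).le, Real.exp_le_one_iff.2 (by linarith)⟩

lemma isHeatFlow_tiltedFlow (hν : ∀ᵐ z ∂ν, z ∈ Metric.closedBall a R) :
    IsHeatFlow ((stdGaussian (EuclideanSpace ℝ (Fin d))).conv ν)
      fun t x => tiltedFlow ν 1 x (Real.exp (-t)) where
  initial x := by simpa using tiltedFlow_self hν (s₀ := 1) ⟨zero_le_one, le_rfl⟩ x
  continuousOn x := (isTiltedTrajectory_tiltedFlow hν ⟨zero_le_one, le_rfl⟩ x).continuousOn.comp
    (by fun_prop) fun _ ht => exp_neg_mem_Icc ht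
  hasDerivAt x t ht := by
    have hs : Real.exp (-t) ∈ Set.Ioo (0 : ℝ) 1 :=
      ⟨Real.exp_pos _, Real.exp_lt_one_iff.2 (by linarith)⟩
    have hexp : HasDerivAt (fun t : ℝ => Real.exp (-t)) (-Real.exp (-t)) t := by
      simpa using (hasDerivAt_neg t).exp
    refine (((isTiltedTrajectory_tiltedFlow hν ⟨zero_le_one, le_rfl⟩ x).hasDerivAt _ hs).scomp t
      hexp).congr_deriv ?_
    rw [heatFlowField_eq hν ht, neg_smul]

lemma IsHeatFlow.eq_tiltedFlow (hν : ∀ᵐ z ∂ν, z ∈ Metric.closedBall a R)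
    {S : ℝ → EuclideanSpace ℝ (Fin d) → EuclideanSpace ℝ (Fin d)}
    (hS : IsHeatFlow ((stdGaussian (EuclideanSpace ℝ (Fin d))).conv ν) S) {t : ℝ} (ht : 0 ≤ t)
    (x : EuclideanSpace ℝ (Fin d)) : S t x = tiltedFlow ν 1 x (Real.exp (-t)) := by
  have hmem := exp_neg_mem_Icc ht
  have hpos : ∀ s ∈ Set.Icc (Real.exp (-t)) 1, 0 < s := fun s hs => (Real.exp_pos _).trans_le hs.1
  -- The inverse time change `t = -log s` is used only on `[exp (-t), 1]`, away from its singularity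
  -- at `0`.
  have htraj : IsTiltedTrajectory ν (fun s => S (-Real.log s) x) (Real.exp (-t)) 1 := by
    refine ⟨(hS.continuousOn x).comp
      (Real.continuousOn_log.mono fun s hs => (hpos s hs).ne').neg fun s hs => ?_, fun s hs => ?_⟩
    · simpa using Real.log_nonpos (hpos s hs).le hs.2
    · have hs0 := hpos s (Set.Ioo_subset_Icc_self hs)
      have hd := (hS.hasDerivAt x (-Real.log s) (by simpa using Real.log_neg hs0 hs.2)).scomp s
        (Real.hasDerivAt_log hs0.ne').neg
      refine hd.congr_deriv ?_
      rw [heatFlowField_eq hν (by simpa using Real.log_neg hs0 hs.2), neg_neg,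
        Real.exp_log hs0, smul_neg, neg_smul, neg_neg, inv_smul_smul₀ hs0.ne']
  have := htraj.eq_tiltedFlow hν hmem.1 le_rfl ⟨hmem.2, le_rfl⟩ ⟨le_rfl, hmem.2⟩
  simpa [hS.initial] using this

lemma isKimMilmanMap_tiltedFlow (hν : ∀ᵐ z ∂ν, z ∈ Metric.closedBall a R) :
    IsKimMilmanMap ((stdGaussian (EuclideanSpace ℝ (Fin d))).conv ν)
      fun x => tiltedFlow ν 0 x 1 := by
  have h1 : (1 : ℝ) ∈ Set.Icc (0 : ℝ) 1 := ⟨zero_le_one, le_rfl⟩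
  refine ⟨_, fun t x => tiltedFlow ν (Real.exp (-t)) x 1, isHeatFlow_tiltedFlow hν,
    fun t ht => ⟨fun x => ?_, fun x => ?_⟩, tendsto_tiltedFlow_exp_neg hν⟩
  · exact (tiltedFlow_tiltedFlow hν h1 (exp_neg_mem_Icc ht) h1 x).trans (tiltedFlow_self hν h1 x)
  · exact (tiltedFlow_tiltedFlow hν (exp_neg_mem_Icc ht) h1 (exp_neg_mem_Icc ht) x).trans
      (tiltedFlow_self hν (exp_neg_mem_Icc ht) x)

lemma IsKimMilmanMap.eq_tiltedFlow (hν : ∀ᵐ z ∂ν, z ∈ Metric.closedBall a R)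
    {Φ : EuclideanSpace ℝ (Fin d) → EuclideanSpace ℝ (Fin d)}
    (hΦ : IsKimMilmanMap ((stdGaussian (EuclideanSpace ℝ (Fin d))).conv ν) Φ) :
    Φ = fun x => tiltedFlow ν 0 x 1 := by
  obtain ⟨S, T, hS, hinv, hlim⟩ := hΦ
  have h1 : (1 : ℝ) ∈ Set.Icc (0 : ℝ) 1 := ⟨zero_le_one, le_rfl⟩
  funext x
  refine tendsto_nhds_unique (hlim x) ((tendsto_tiltedFlow_exp_neg hν x).congr' ?_)
  filter_upwards [eventually_ge_atTop 0] with t ht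
  have hx : tiltedFlow ν 1 (T t x) (Real.exp (-t)) = x := by
    rw [← hS.eq_tiltedFlow hν ht]
    exact (hinv t ht).2 x
  calc tiltedFlow ν (Real.exp (-t)) x 1
      = tiltedFlow ν (Real.exp (-t)) (tiltedFlow ν 1 (T t x) (Real.exp (-t))) 1 := by rw [hx]
    _ = T t x := (tiltedFlow_tiltedFlow hν h1 (exp_neg_mem_Icc ht) h1 _).trans
        (tiltedFlow_self hν h1 _)

end KimMilman

end

theorem theorem1p2 (d : ℕ) (R : ℝ) (a : EuclideanSpace ℝ (Fin d))
    (ν μ : Measure (EuclideanSpace ℝ (Fin d))) [IsProbabilityMeasure ν]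
    (hν : ν.support ⊆ Metric.closedBall a R)
    (hμ : μ = (stdGaussian (EuclideanSpace ℝ (Fin d))).conv ν) :
    (∃! Φ : EuclideanSpace ℝ (Fin d) → EuclideanSpace ℝ (Fin d), IsKimMilmanMap μ Φ) ∧
    ∀ Φ : EuclideanSpace ℝ (Fin d) → EuclideanSpace ℝ (Fin d), IsKimMilmanMap μ Φ →
      MeasurePreserving Φ (stdGaussian (EuclideanSpace ℝ (Fin d))) μ ∧
      (∀ᵐ x : EuclideanSpace ℝ (Fin d),
        DifferentiableAt ℝ Φ x ∧ ‖fderiv ℝ Φ x‖ ≤ Real.exp (R ^ 2 / 2)) ∧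
      ∀ x y, ‖Φ x - Φ y‖ ≤ Real.exp (R ^ 2 / 2) * ‖x - y‖ := by
  have hball : ∀ᵐ z ∂ν, z ∈ Metric.closedBall a R :=
    Filter.mem_of_superset Measure.support_mem_ae hν
  subst hμ
  refine ⟨⟨_, isKimMilmanMap_tiltedFlow hball, fun Φ hΦ => hΦ.eq_tiltedFlow hball⟩,
    fun Φ hΦ => ?_⟩
  obtain rfl := hΦ.eq_tiltedFlow hball
  have hlip := lipschitzWith_tiltedFlow_zero_one hball
  refine ⟨measurePreserving_tiltedFlow hball, ?_,
    norm_tiltedFlow_sub_tiltedFlow_le hball le_rfl zero_le_one le_rfl⟩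
  filter_upwards [hlip.ae_differentiableAt] with x hx
  refine ⟨hx, ?_⟩
  simpa only [Real.coe_toNNReal _ (Real.exp_pos (R ^ 2 / 2)).le] using
    norm_fderiv_le_of_lipschitz ℝ (x₀ := x) hlip
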